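/- Let $X$ be a finite alphabet. Put $X_\varepsilon = X\cup\{\varepsilon\}$ and let $\pi\colon (X_\varepsilon\times X_\varepsilon)^*\to X^*\times X^*$ be the map $(x_1,y_1)\cdots(x_k,y_k)\mapsto (x_1\cdots x_k,\;y_1\cdots y_k)$. For a class $\mathfrak C$ of languages and a binary relation $\rho\subseteq X^*\times X^*$, write $\rho\in T(\mathfrak C)$ if $\rho=L\pi$ for some language $L\in\mathfrak C$ over the alphabet $X_\varepsilon\times X_\varepsilon$, and write $\rho\in U(\mathfrak C)$ if the language $L_\rho=\{u\#v^{\mathrm{rev}} : (u,v)\in\rho\}$ over $X\cup\{\#\}$, where $\#\notin X$, belongs to $\mathfrak C$. Let $\mathcal{CF}$ be the class of context-free languages and $\mathcal{LIN}$ the class of linear indexed languages, that is, the languages generated by grammars with finitely many productions in which each non-terminal carries a stack of flags and each production has one of the following two forms: - $A[\alpha\,\cdot\cdot]\to \Gamma_1\,B[\beta\,\cdot\cdot]\,\Gamma_2$, where $\alpha,\beta$ are finite strings of flags and $\Gamma_1,\Gamma_2$ are words over terminals and non-terminals with fixed flag stacks; it removes $\alpha$ from the top of the stack of $A$ and copies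 the remaining flags to the single non-terminal $B$, pushing $\beta$ on top of them; - $A[\alpha]\to w$, where $w$ is a word of terminals; it applies when the stack of $A$ is exactly $\alpha$. Derivations begin with the start symbol carrying the empty stack. Then every relation $\rho\subseteq X^*\times X^*$ in $T(\mathcal{CF})$ is in $U(\mathcal{LIN})$. If $|X|\ge 2$, the containment is proper: there is a relation $\rho\subseteq X^*\times X^*$ in $U(\mathcal{LIN})$ that is not in $T(\mathcal{CF})$. In particular, $T(\mathcal{CF})\subsetneq U(\mathcal{LIN})$ as classes of relations over finite alphabets. -/

import Mathlib

universe u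

/-- A sentential form of an indexed grammar: a word over terminals and non-terminals,
each non-terminal carrying a stack of flags (the head of the list is the top of the stack). -/
abbrev IndexedForm (T N F : Type u) : Type u := List (Symbol T (N × List F))

/-- A production of a linear indexed grammar. -/
inductive LinearIndexedRule (T N F : Type u) : Type u where
  /-- `A[pop ··] → left B[push ··] right`: the flags `pop` are removed from the top of the stack
  of `A`, the remaining flags `··` are copied to the single non-terminal `B`, on which `push` is
  then pushed. All other non-terminals on the right-hand side get the fixed stacks written in
  `left` and `right`. -/
  | copy (A : N) (pop : List F) (left : IndexedForm T N F) (B : N) (push : List F)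
      (right : IndexedForm T N F)
  /-- `A[stack] → out`, with only terminals on the right-hand side; it applies to `A` when the
  flags on `A` are exactly `stack`. -/
  | terminate (A : N) (stack : List F) (out : List T)

/-- `r.Instance B τ γ` means that the production `r` allows to replace the non-terminal `B` with
stack `τ` by the sentential form `γ`. -/
inductive LinearIndexedRule.Instance {T N F : Type u} :
    LinearIndexedRule T N F → N → List F → IndexedForm T N F → Prop
  | copy (A : N) (pop : List F) (left : IndexedForm T N F) (B : N) (push : List F)
      (right : IndexedForm T N F) (rest : List F) :
      Instance (.copy A pop left B push right) A (pop ++ rest)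
        (left ++ [Symbol.nonterminal (B, push ++ rest)] ++ right)
  | terminate (A : N) (stack : List F) (out : List T) :
      Instance (.terminate A stack out) A stack (out.map Symbol.terminal)

/-- A linear indexed grammar over the terminal alphabet `T`, in the sense that a production copies
the flags to only one of the non-terminals on its right-hand side.
As for `ContextFreeGrammar`, finiteness is imposed on the set of productions, so that only finitely
many non-terminals and flags occur in them. -/
structure LinearIndexedGrammar (T : Type u) where
  /-- Non-terminals. -/
  NT : Type u
  /-- Flags. -/
  Flag : Type u
  /-- Start symbol. -/
  initial : NT
  /-- Productions. -/
  rules : Finset (LinearIndexedRule T NT Flag)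

namespace LinearIndexedGrammar

/-- One derivation step: one non-terminal, with its stack, is rewritten by a production. -/
def Produces {T : Type u} (g : LinearIndexedGrammar T) (s t : IndexedForm T g.NT g.Flag) : Prop :=
  ∃ r ∈ g.rules, ∃ (A : g.NT) (stack : List g.Flag) (γ p q : IndexedForm T g.NT g.Flag),
    r.Instance A stack γ ∧ s = p ++ [Symbol.nonterminal (A, stack)] ++ q ∧ t = p ++ γ ++ q

/-- Derivations of any finite number of steps. -/
def Derives {T : Type u} (g : LinearIndexedGrammar T) :
    IndexedForm T g.NT g.Flag → IndexedForm T g.NT g.Flag → Prop :=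
  Relation.ReflTransGen g.Produces

/-- The language of terminal words derivable from the start symbol with empty stack. -/
def language {T : Type u} (g : LinearIndexedGrammar T) : Language T :=
  { w : List T | g.Derives [Symbol.nonterminal (g.initial, [])] (w.map Symbol.terminal) }

end LinearIndexedGrammar

/-- A class of languages: for every alphabet, a set of languages over it. -/
abbrev LanguageClass : Type (u + 1) := (α : Type u) → Set (Language α)

/-- The class of context-free languages. -/
def classCF : LanguageClass.{u} := fun α => { L : Language α | L.IsContextFree }

/-- The class of linear indexed languages. -/
def classLIN : LanguageClass.{u} :=
  fun α => { L : Language α | ∃ g : LinearIndexedGrammar α, g.language = L }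

/-- The map `π` sending `(x₁,y₁)⋯(xₖ,yₖ)` to `(x₁⋯xₖ, y₁⋯yₖ)`, where the letters `xᵢ`, `yᵢ` lie in
`X ∪ {ε}`; here `X ∪ {ε}` is `Option X`, with `none` for `ε`. -/
def tapes {X : Type u} (w : List (Option X × Option X)) : List X × List X :=
  (w.filterMap Prod.fst, w.filterMap Prod.snd)

/-- `T(C)` over the alphabet `X`: the binary relations `ρ` on words over `X` with `ρ = Lπ` for some
language `L` in `C` over the alphabet `(X ∪ {ε}) × (X ∪ {ε})`. -/
def twoTape (C : LanguageClass.{u}) (X : Type u) : Set (Set (List X × List X)) :=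
  { ρ | ∃ L ∈ C (Option X × Option X), ρ = tapes '' (L : Set (List (Option X × Option X))) }

/-- The word `u # v^rev`, over `X ∪ {#}`; here `X ∪ {#}` is `Option X`, with `none` for `#`. -/
def unfoldWord {X : Type u} (p : List X × List X) : List (Option X) :=
  p.1.map some ++ [none] ++ (p.2.reverse).map some

/-- The language `L_ρ = { u # v^rev | (u, v) ∈ ρ }`. -/
def unfoldLanguage {X : Type u} (ρ : Set (List X × List X)) : Language (Option X) :=
  unfoldWord '' ρ

/-- `U(C)` over the alphabet `X`: the binary relations `ρ` on words over `X` with `L_ρ` in `C`. -/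
def unfolded (C : LanguageClass.{u}) (X : Type u) : Set (Set (List X × List X)) :=
  { ρ | unfoldLanguage ρ ∈ C (Option X) }

/-! A leftmost derivation of a context-free grammar is a pushdown process, and the single flag stack
of a linear indexed grammar can hold that pushdown. Popping a letter `(x, y)` writes `x` to the left
and `y` to the right of the only non-terminal, so the second tape comes out reversed; `#` is written
when the stack is empty (`twoTape_classCF_subset`).

For properness take all pairs `(aⁿbaⁿbaⁿ, ε)`. A flag stack counts the outer blocks and replays the
count in the middle. On the context-free side, `Parses.exists_subtree` finds subtrees of controlled
weight; by pigeonhole two of very different weights have the same root. Grafting the heavier one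
into the other's tree changes the length of the first tape, while the untouched part already fixes
`n` (`eq_of_threeBlocks_exchange`), a contradiction. -/

/-! ### Linear indexed grammars with at most one non-terminal per sentential form. -/

section LinearDerivations

variable {T N F : Type u}

/-- `LinearIndexedRule.Generates R A σ w`: the non-terminal `A` with stack `σ` yields `w` by
productions in `R` whose right-hand sides contain at most one non-terminal. -/
inductive LinearIndexedRule.Generates (R : Set (LinearIndexedRule T N F)) :
    N → List F → List T → Prop
  | copy {A : N} {pop : List F} {l : List T} {B : N} {push : List F} {r : List T}
      (rest : List F) {w : List T}
      (hr : .copy A pop (l.map Symbol.terminal) B push (r.map Symbol.terminal) ∈ R)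
      (hw : Generates R B (push ++ rest) w) : Generates R A (pop ++ rest) (l ++ w ++ r)
  | terminate {A : N} {stack : List F} {out : List T}
      (hr : .terminate A stack out ∈ R) : Generates R A stack out

/-- The production has at most one non-terminal on its right-hand side. -/
def LinearIndexedRule.IsLinear : LinearIndexedRule T N F → Prop
  | .copy _ _ left _ _ right =>
      ∃ l r : List T, left = l.map Symbol.terminal ∧ right = r.map Symbol.terminal
  | .terminate _ _ _ => True

theorem append_nonterminal_inj {u v : List T} {p q : List (Symbol T N)} {A B : N}
    (h : u.map Symbol.terminal ++ [Symbol.nonterminal A] ++ v.map Symbol.terminal =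
      p ++ [Symbol.nonterminal B] ++ q) :
    p = u.map Symbol.terminal ∧ A = B ∧ q = v.map Symbol.terminal := by
  induction u generalizing p with
  | nil =>
    cases p with
    | nil => simp_all
    | cons c p =>
      have hm : Symbol.nonterminal B ∈ v.map (Symbol.terminal (N := N)) := by
        simp only [List.map_nil, List.nil_append, List.cons_append, List.cons.injEq] at h
        rw [h.2]; simp
      simp at hm
  | cons t u ih =>
    cases p with
    | nil => simp at h
    | cons c p =>
      simp only [List.map_cons, List.cons_append, List.cons.injEq] at h
      obtain ⟨h1, h2, h3⟩ := ih h.2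
      exact ⟨by rw [List.map_cons, ← h.1, h1], h2, h3⟩

namespace LinearIndexedGrammar

variable {g : LinearIndexedGrammar T}

theorem Produces.append {s t : IndexedForm T g.NT g.Flag} (h : g.Produces s t)
    (l r : IndexedForm T g.NT g.Flag) : g.Produces (l ++ s ++ r) (l ++ t ++ r) := by
  obtain ⟨ρ, hρ, A, σ, γ, p, q, hi, rfl, rfl⟩ := h
  exact ⟨ρ, hρ, A, σ, γ, l ++ p, q ++ r, hi, by simp, by simp⟩

theorem Derives.append {s t : IndexedForm T g.NT g.Flag} (h : g.Derives s t)
    (l r : IndexedForm T g.NT g.Flag) : g.Derives (l ++ s ++ r) (l ++ t ++ r) := by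
  induction h with
  | refl => exact Relation.ReflTransGen.refl
  | tail _ hst ih => exact Relation.ReflTransGen.tail ih (hst.append l r)

theorem derives_of_generates {A : g.NT} {σ : List g.Flag} {w : List T}
    (h : LinearIndexedRule.Generates g.rules A σ w) :
    g.Derives [Symbol.nonterminal (A, σ)] (w.map Symbol.terminal) := by
  induction h with
  | @copy A pop l B push r rest w hr _ ih =>
    have h := Derives.append ih (l.map Symbol.terminal) (r.map Symbol.terminal)
    rw [← List.map_append, ← List.map_append] at h
    exact Relation.ReflTransGen.head
      ⟨_, hr, A, pop ++ rest, _, [], [], .copy .., by simp, by simp⟩ h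
  | @terminate A σ out hr =>
    exact Relation.ReflTransGen.single ⟨_, hr, A, σ, _, [], [], .terminate .., by simp, by simp⟩

/-- Linear productions keep the form `u A[σ] v` with `u`, `v` terminal, so each step must rewrite
that one non-terminal; `u` and `v` vary because they grow along the derivation. -/
theorem exists_generates_of_derives (hg : ∀ r ∈ g.rules, r.IsLinear)
    {s : IndexedForm T g.NT g.Flag} {w : List T} (h : g.Derives s (w.map Symbol.terminal)) :
    ∀ {u v : List T} {A : g.NT} {σ : List g.Flag},
      s = u.map Symbol.terminal ++ [Symbol.nonterminal (A, σ)] ++ v.map Symbol.terminal →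
      ∃ w', w = u ++ w' ++ v ∧ LinearIndexedRule.Generates g.rules A σ w' := by
  induction h using Relation.ReflTransGen.head_induction_on with
  | refl =>
    intro u v A σ h
    have hm : Symbol.nonterminal (A, σ) ∈ w.map Symbol.terminal := by rw [h]; simp
    simp at hm
  | head hp hd ih =>
    intro u v A σ hs
    obtain ⟨r, hr, B, τ, γ, p, q, hi, rfl, rfl⟩ := hp
    obtain ⟨rfl, hA, rfl⟩ := append_nonterminal_inj hs.symm
    obtain ⟨rfl, rfl⟩ := Prod.mk.inj hA
    have hl := hg r hr
    cases hi with
    | copy A pop left B push right rest =>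
      obtain ⟨l, r, rfl, rfl⟩ := hl
      obtain ⟨w', rfl, hw'⟩ := ih (u := u ++ l) (v := r ++ v) (A := B) (σ := push ++ rest)
        (by simp)
      exact ⟨l ++ w' ++ r, by simp, .copy rest hr hw'⟩
    | terminate A σ out =>
      refine ⟨out, ?_, .terminate hr⟩
      clear ih
      rw [← List.map_append, ← List.map_append] at hd
      -- The form is now terminal, so the remaining derivation has no steps.
      rcases Relation.ReflTransGen.cases_head hd with he | ⟨_, ⟨_, _, C, κ, _, p, q, _, he, _⟩, _⟩
      · exact (List.map_injective_iff.2 (fun _ _ h => Symbol.terminal.inj h) he).symm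
      · have hm : Symbol.nonterminal (C, κ) ∈ (u ++ out ++ v).map Symbol.terminal := by
          rw [he]; simp
        simp at hm

end LinearIndexedGrammar

theorem LinearIndexedRule.mem_classLIN_of_generates {R : Set (LinearIndexedRule T N F)}
    (hR : R.Finite) (hl : ∀ r ∈ R, r.IsLinear) (S : N) {L : Language T}
    (hL : ∀ w, w ∈ L ↔ Generates R S [] w) : L ∈ classLIN T := by
  refine ⟨⟨N, F, S, hR.toFinset⟩, ?_⟩
  have he : (↑hR.toFinset : Set (LinearIndexedRule T N F)) = R := hR.coe_toFinset
  ext w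
  rw [hL]
  constructor
  · intro h
    obtain ⟨w', rfl, hw'⟩ := LinearIndexedGrammar.exists_generates_of_derives
      (fun r hr => hl r (hR.mem_toFinset.1 hr)) h (u := []) (v := []) rfl
    simp only [he] at hw'
    simpa using hw'
  · intro h
    refine LinearIndexedGrammar.derives_of_generates ?_
    simpa only [he] using h

end LinearDerivations

/-! ### Derivation forests of context-free grammars and heavy subtrees. -/

section ParseForests

variable {T : Type u}

namespace ContextFreeGrammar

/-- `g.Parses s w`: there is a forest of derivation trees of `g` with roots `s` and yield `w`. -/
inductive Parses (g : ContextFreeGrammar T) : List (Symbol T g.NT) → List T → Prop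
  | nil : Parses g [] []
  | terminal (t : T) {s : List (Symbol T g.NT)} {w : List T} (h : Parses g s w) :
      Parses g (.terminal t :: s) (t :: w)
  | nonterminal {r : ContextFreeRule T g.NT} (hr : r ∈ g.rules) {s : List (Symbol T g.NT)}
      {w₁ w₂ : List T} (h₁ : Parses g r.output w₁) (h₂ : Parses g s w₂) :
      Parses g (.nonterminal r.input :: s) (w₁ ++ w₂)

variable {g : ContextFreeGrammar T}

theorem Parses.append {s t : List (Symbol T g.NT)} {v w : List T} (hs : g.Parses s v)
    (ht : g.Parses t w) : g.Parses (s ++ t) (v ++ w) := by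
  induction hs with
  | nil => exact ht
  | terminal a _ ih => exact ih.terminal a
  | nonterminal hr h₁ _ _ ih₂ => simpa using Parses.nonterminal hr h₁ ih₂

theorem Parses.exists_of_append {s t : List (Symbol T g.NT)} {w : List T}
    (h : g.Parses (s ++ t) w) : ∃ w₁ w₂, w = w₁ ++ w₂ ∧ g.Parses s w₁ ∧ g.Parses t w₂ := by
  induction s generalizing w with
  | nil => exact ⟨[], w, rfl, .nil, h⟩
  | cons c s ih =>
    cases h with
    | terminal a h =>
      obtain ⟨w₁, w₂, rfl, h₁, h₂⟩ := ih h
      exact ⟨a :: w₁, w₂, rfl, h₁.terminal a, h₂⟩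
    | nonterminal hr h h' =>
      obtain ⟨w₁, w₂, rfl, h₁, h₂⟩ := ih h'
      exact ⟨_, w₂, by simp, .nonterminal hr h h₁, h₂⟩

theorem parses_map_terminal (w : List T) : g.Parses (w.map Symbol.terminal) w := by
  induction w with
  | nil => exact .nil
  | cons a w ih => exact ih.terminal a

theorem Derives.parses {s : List (Symbol T g.NT)} {w : List T}
    (h : g.Derives s (w.map Symbol.terminal)) : g.Parses s w := by
  induction h using Relation.ReflTransGen.head_induction_on with
  | refl => exact parses_map_terminal w
  | head hp _ ih =>
    obtain ⟨r, hr, hrw⟩ := hp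
    obtain ⟨p, q, rfl, rfl⟩ := hrw.exists_parts
    obtain ⟨_, w₃, rfl, h, h₃⟩ := ih.exists_of_append
    obtain ⟨w₁, w₂, rfl, h₁, h₂⟩ := h.exists_of_append
    exact (h₁.append (by simpa using Parses.nonterminal hr h₂ .nil)).append h₃

theorem Parses.derives {s : List (Symbol T g.NT)} {w : List T} (h : g.Parses s w) :
    g.Derives s (w.map Symbol.terminal) := by
  induction h with
  | nil => exact Relation.ReflTransGen.refl
  | terminal a _ ih => exact ContextFreeGrammar.Derives.append_left ih [.terminal a]
  | @nonterminal r hr s w₁ w₂ _ _ ih₁ ih₂ =>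
    rw [List.map_append]
    exact .head ⟨r, hr, .head s⟩
      ((ContextFreeGrammar.Derives.append_right ih₁ s).trans
        (ContextFreeGrammar.Derives.append_left ih₂ _))

theorem mem_language_iff_parses {w : List T} :
    w ∈ g.language ↔ g.Parses [.nonterminal g.initial] w :=
  ⟨fun h => Derives.parses h, fun h => h.derives⟩

/-- A forest whose yield is heavy, for a weight `f` of letters, has a subtree whose yield has weight
between `k` and `k` times the length of the longest right-hand side; the subtree may be replaced by
any other one with the same root. -/
theorem Parses.exists_subtree {X : Type*} (f : T → Option X) {k m : ℕ} (hk : 1 ≤ k)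
    (hm : ∀ r ∈ g.rules, r.output.length ≤ m) {s : List (Symbol T g.NT)} {w : List T}
    (h : g.Parses s w) :
    (w.filterMap f).length ≤ k * s.length ∨
      ∃ r ∈ g.rules, ∃ x y z, w = x ++ y ++ z ∧ k < (y.filterMap f).length ∧
        (y.filterMap f).length ≤ k * m ∧ g.Parses [.nonterminal r.input] y ∧
        ∀ y', g.Parses [.nonterminal r.input] y' → g.Parses s (x ++ y' ++ z) := by
  induction h with
  | nil => simp
  | @terminal t s w h ih =>
    rcases ih with ih | ⟨r, hr, x, y, z, rfl, h₁, h₂, h₃, h₄⟩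
    · left
      have : ((t :: w).filterMap f).length ≤ (w.filterMap f).length + 1 := by
        rw [List.filterMap_cons]; split <;> simp
      rw [List.length_cons, mul_add]
      omega
    · exact .inr ⟨r, hr, t :: x, y, z, rfl, h₁, h₂, h₃, fun y' hy' => (h₄ y' hy').terminal t⟩
  | @nonterminal r hr s w₁ w₂ h h' ih₁ ih₂ =>
    rcases ih₂ with ih₂ | ⟨r', hr', x, y, z, rfl, h₁, h₂, h₃, h₄⟩
    · rcases ih₁ with ih₁ | ⟨r', hr', x, y, z, rfl, h₁, h₂, h₃, h₄⟩
      -- No heavy subtree was found below this root. If its own yield exceeds `k`, it is the subtree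
      -- sought: the bound on its forest of children gives at most `k * m`.
      · by_cases hw : (w₁.filterMap f).length ≤ k
        · left
          rw [List.filterMap_append, List.length_append, List.length_cons, mul_add]
          omega
        · exact .inr ⟨r, hr, [], w₁, w₂, rfl, not_le.1 hw,
            ih₁.trans (Nat.mul_le_mul_left k (hm r hr)), by simpa using Parses.nonterminal hr h .nil,
            fun y' hy' => hy'.append h'⟩
      · exact .inr ⟨r', hr', x, y, z ++ w₂, by simp, h₁, h₂, h₃, fun y' hy' => by
          simpa using Parses.nonterminal hr (h₄ y' hy') h'⟩
    · exact .inr ⟨r', hr', w₁ ++ x, y, z, by simp, h₁, h₂, h₃, fun y' hy' => by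
        simpa using Parses.nonterminal hr h (h₄ y' hy')⟩

end ContextFreeGrammar

end ParseForests

/-! ### The inclusion: simulating a pushdown on the flag stack. -/

section Unfolding

variable {X : Type u}

theorem unfoldWord_tapes_cons (p : Option X × Option X) (w : List (Option X × Option X)) :
    unfoldWord (tapes (p :: w)) =
      (p.1.map some).toList ++ unfoldWord (tapes w) ++ (p.2.map some).toList := by
  obtain ⟨_ | x, _ | y⟩ := p <;> simp [unfoldWord, tapes]

/-- The productions of a linear indexed grammar whose stack is the pushdown of a leftmost derivation
of `g`. -/
def leftmostRules (g : ContextFreeGrammar (Option X × Option X)) :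
    Set (LinearIndexedRule (Option X) (ULift.{u} Bool) (Symbol (Option X × Option X) g.NT)) :=
  {.copy ⟨false⟩ [] [] ⟨true⟩ [.nonterminal g.initial] []} ∪
  (fun r : ContextFreeRule (Option X × Option X) g.NT =>
    .copy ⟨true⟩ [.nonterminal r.input] [] ⟨true⟩ r.output []) '' ↑g.rules ∪
  Set.range (fun p => .copy ⟨true⟩ [.terminal p] ((p.1.map some).toList.map .terminal) ⟨true⟩ []
    ((p.2.map some).toList.map .terminal)) ∪
  {.terminate ⟨true⟩ [] [none]}

/-- Finiteness of `X` matters here: there is one production for each pair of letters. -/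
theorem finite_leftmostRules [Finite X] (g : ContextFreeGrammar (Option X × Option X)) :
    (leftmostRules g).Finite :=
  (((Set.finite_singleton _).union (g.rules.finite_toSet.image _)).union
    (Set.finite_range _)).union (Set.finite_singleton _)

theorem leftmostRules_isLinear (g : ContextFreeGrammar (Option X × Option X)) :
    ∀ r ∈ leftmostRules g, r.IsLinear := by
  rintro r (((rfl | ⟨r, _, rfl⟩) | ⟨p, rfl⟩) | rfl)
  · exact ⟨[], [], rfl, rfl⟩
  · exact ⟨[], [], rfl, rfl⟩
  · exact ⟨_, _, rfl, rfl⟩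
  · trivial

open LinearIndexedRule

/-- The rest `t` of the stack acts as a continuation: once `s` has been consumed, the derivation
from `t` takes over. This lets the two forests at a non-terminal be chained. -/
theorem generates_leftmostRules_of_parses
    {g : ContextFreeGrammar (Option X × Option X)} {s : List (Symbol (Option X × Option X) g.NT)}
    {v : List (Option X × Option X)} (h : g.Parses s v) :
    ∀ {t : List (Symbol (Option X × Option X) g.NT)} {w : List (Option X × Option X)},
      Generates (leftmostRules g) ⟨true⟩ t (unfoldWord (tapes w)) →
      Generates (leftmostRules g) ⟨true⟩ (s ++ t) (unfoldWord (tapes (v ++ w))) := by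
  induction h with
  | nil => exact fun h => h
  | @terminal p s v _ ih =>
    intro t w h
    rw [List.cons_append, List.cons_append, unfoldWord_tapes_cons]
    exact .copy (pop := [.terminal p]) (push := []) (s ++ t) (Or.inl (Or.inr ⟨p, rfl⟩)) (ih h)
  | @nonterminal r hr s w₁ w₂ _ _ ih₁ ih₂ =>
    intro t w h
    have := Generates.copy (l := []) (r := []) (pop := [.nonterminal r.input]) (s ++ t)
      (Or.inl (Or.inl (Or.inr ⟨r, hr, rfl⟩))) (ih₁ (ih₂ h))
    simpa using this

/-- The `if` accounts for the start state, whose production pushes the initial symbol onto whatever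
stack is present. -/
theorem exists_parses_of_generates_leftmostRules
    {g : ContextFreeGrammar (Option X × Option X)} {A : ULift.{u} Bool}
    {s : List (Symbol (Option X × Option X) g.NT)} {z : List (Option X)}
    (h : Generates (leftmostRules g) A s z) :
    ∃ w, g.Parses (if A.down then s else .nonterminal g.initial :: s) w ∧
      z = unfoldWord (tapes w) := by
  induction h with
  | @copy A pop l B push r' rest w hr _ ih =>
    obtain ⟨w, hw, rfl⟩ := ih
    rcases hr with ((h | ⟨r, hr', h⟩) | ⟨p, h⟩) | h
    · simp only [Set.mem_singleton_iff, LinearIndexedRule.copy.injEq, List.map_eq_nil_iff] at h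
      obtain ⟨rfl, rfl, rfl, rfl, rfl, rfl⟩ := h
      exact ⟨w, by simpa using hw, by simp⟩
    · simp only [LinearIndexedRule.copy.injEq, List.nil_eq, List.map_eq_nil_iff] at h
      obtain ⟨rfl, rfl, rfl, rfl, rfl, rfl⟩ := h
      obtain ⟨w₁, w₂, rfl, h₁, h₂⟩ := ContextFreeGrammar.Parses.exists_of_append hw
      exact ⟨_, .nonterminal hr' h₁ h₂, by simp⟩
    · have hinj : Function.Injective (List.map (Symbol.terminal (T := Option X)
          (N := ULift.{u} Bool × List (Symbol (Option X × Option X) g.NT)))) :=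
        List.map_injective_iff.2 fun _ _ h => Symbol.terminal.inj h
      simp only [LinearIndexedRule.copy.injEq, hinj.eq_iff] at h
      obtain ⟨rfl, rfl, rfl, rfl, rfl, rfl⟩ := h
      exact ⟨p :: w, .terminal p hw, (unfoldWord_tapes_cons p w).symm⟩
    · cases h
  | terminate hr =>
    rcases hr with ((h | ⟨r, hr', h⟩) | ⟨p, h⟩) | h
    · cases h
    · cases h
    · cases h
    · cases h
      exact ⟨[], .nil, rfl⟩

theorem twoTape_classCF_subset [Finite X] : twoTape classCF X ⊆ unfolded classLIN X := by
  rintro _ ⟨_, ⟨g, rfl⟩, rfl⟩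
  refine mem_classLIN_of_generates (finite_leftmostRules g) (leftmostRules_isLinear g) ⟨false⟩ ?_
  intro z
  constructor
  · rintro ⟨_, ⟨w, hw, rfl⟩, rfl⟩
    have h := generates_leftmostRules_of_parses (ContextFreeGrammar.mem_language_iff_parses.1 hw)
      (t := []) (w := []) (.terminate (Or.inr rfl))
    have h' := Generates.copy (l := []) (r := []) (pop := []) []
      (Or.inl (Or.inl (Or.inl rfl))) h
    simpa using h'
  · intro h
    obtain ⟨w, hw, rfl⟩ := exists_parses_of_generates_leftmostRules h
    exact ⟨_, ⟨w, ContextFreeGrammar.mem_language_iff_parses.2 hw, rfl⟩, rfl⟩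

end Unfolding

/-! ### Properness: three equal blocks on the first tape. -/

section ThreeBlocks

variable {X : Type u}

/-- The word `aⁿbaⁿbaⁿ`. -/
def threeBlocks (a b : X) (n : ℕ) : List X :=
  List.replicate n a ++ b :: (List.replicate n a ++ b :: List.replicate n a)

theorem length_threeBlocks (a b : X) (n : ℕ) : (threeBlocks a b n).length = 3 * n + 2 := by
  simp [threeBlocks]
  omega

theorem reverse_threeBlocks (a b : X) (n : ℕ) :
    (threeBlocks a b n).reverse = threeBlocks a b n := by
  simp [threeBlocks]

theorem replicate_append_cons_inj {a b : X} (hab : a ≠ b) {m n : ℕ} {s t : List X}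
    (h : List.replicate m a ++ b :: s = List.replicate n a ++ b :: t) : m = n := by
  induction m generalizing n with
  | zero => cases n <;> simp_all [List.replicate_succ, eq_comm]
  | succ m ih => cases n <;> simp_all [List.replicate_succ]

/-- A prefix longer than `n` contains the first `b`, whose position is the block length. -/
theorem eq_of_threeBlocks_prefix {a b : X} (hab : a ≠ b) {m n : ℕ} {x s t : List X}
    (hn : threeBlocks a b n = x ++ s) (hx : n < x.length) (hm : threeBlocks a b m = x ++ t) :
    m = n := by
  rcases List.append_eq_append_iff.1 hn with ⟨c, rfl, hc⟩ | ⟨c, hc, _⟩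
  · cases c with
    | nil => simp at hx
    | cons d c =>
      obtain ⟨rfl, -⟩ := List.cons.inj hc
      rw [List.append_assoc, List.cons_append] at hm
      exact replicate_append_cons_inj hab hm
  · have := congrArg List.length hc
    simp at this
    omega

theorem eq_of_threeBlocks_exchange {a b : X} (hab : a ≠ b) {m n : ℕ} {x y y' z : List X}
    (hn : threeBlocks a b n = x ++ y ++ z) (hy : y.length ≤ n)
    (hm : threeBlocks a b m = x ++ y' ++ z) : m = n := by
  have hl := congrArg List.length hn
  rw [length_threeBlocks, List.length_append, List.length_append] at hl
  -- Since `x` and `z` together have length at least `2n + 2`, one of them is longer than `n`; the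
  -- word is a palindrome, so reversal handles `z`.
  by_cases hx : n < x.length
  · rw [List.append_assoc] at hn hm
    exact eq_of_threeBlocks_prefix hab hn hx hm
  · apply_fun List.reverse at hn hm
    rw [reverse_threeBlocks, List.reverse_append] at hn hm
    exact eq_of_threeBlocks_prefix hab hn (by rw [List.length_reverse]; omega) hm

/-- The relation relating `aⁿbaⁿbaⁿ` to the empty word, for all `n`. -/
def threeBlocksRel (a b : X) : Set (List X × List X) :=
  Set.range fun n => (threeBlocks a b n, [])

theorem threeBlocksRel_not_mem_twoTape {a b : X} (hab : a ≠ b) :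
    threeBlocksRel a b ∉ twoTape classCF X := by
  rintro ⟨_, ⟨g, rfl⟩, hg⟩
  obtain ⟨m, hm₀, hm⟩ : ∃ m, 1 ≤ m ∧ ∀ r ∈ g.rules, r.output.length ≤ m :=
    -- The `+ 1` ensures `1 ≤ m`, so that `3km + 2 > k` rules out the light alternative below.
    ⟨g.rules.sup (fun r => r.output.length) + 1, by omega, fun r hr =>
      (Finset.le_sup (f := fun r => r.output.length) hr).trans (Nat.le_succ _)⟩
  have key : ∀ k : ℕ, 1 ≤ k → ∃ r : g.rules, ∃ x y z,
      threeBlocks a b (k * m) = List.filterMap Prod.fst (x ++ y ++ z) ∧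
      k < (y.filterMap Prod.fst).length ∧ (y.filterMap Prod.fst).length ≤ k * m ∧
      g.Parses [.nonterminal r.1.input] y ∧
      ∀ y', g.Parses [.nonterminal r.1.input] y' → x ++ y' ++ z ∈ g.language := by
    intro k hk
    obtain ⟨w, hw, hwt⟩ : (threeBlocks a b (k * m), []) ∈ tapes '' (g.language : Set _) := by
      rw [← hg]; exact ⟨_, rfl⟩
    have hw₁ : w.filterMap Prod.fst = threeBlocks a b (k * m) := congrArg Prod.fst hwt
    rcases (ContextFreeGrammar.mem_language_iff_parses.1 hw).exists_subtree Prod.fst hk hm with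
      h | ⟨r, hr, x, y, z, rfl, h₁, h₂, h₃, h₄⟩
    · rw [hw₁, length_threeBlocks] at h
      have := Nat.mul_le_mul_left k hm₀
      simp at h
      omega
    · exact ⟨⟨r, hr⟩, x, y, z, hw₁.symm, h₁, h₂, h₃, fun y' hy' =>
        ContextFreeGrammar.mem_language_iff_parses.2 (h₄ y' hy')⟩
  -- With `k = (m + 1) ^ i` the weight ranges `(k, km]` are disjoint for different `i`.
  choose r x y z h₁ h₂ h₃ h₄ h₅ using fun i : ℕ => key ((m + 1) ^ i) (Nat.one_le_pow _ _ (by omega))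
  obtain ⟨i, j, hij, hr⟩ : ∃ i j, i < j ∧ r i = r j := by
    obtain ⟨i, j, hij, hr⟩ := Finite.exists_ne_map_eq_of_infinite r
    rcases hij.lt_or_gt with h | h
    exacts [⟨i, j, h, hr⟩, ⟨j, i, h, hr.symm⟩]
  have hmem : tapes (x i ++ y j ++ z i) ∈ threeBlocksRel a b := by
    rw [hg]; exact ⟨_, h₅ i _ (hr ▸ h₄ j), rfl⟩
  obtain ⟨n, hn⟩ := hmem
  have hn₁ : threeBlocks a b n = (x i ++ y j ++ z i).filterMap Prod.fst := congrArg Prod.fst hn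
  have hi := h₁ i
  rw [List.filterMap_append, List.filterMap_append] at hn₁ hi
  -- The replaced part is no longer than a block, so the exchange preserves the block length; hence
  -- `y i` and `y j` have equal weight.
  obtain rfl := eq_of_threeBlocks_exchange hab hi (h₃ i) hn₁
  have hl := congrArg List.length (hi.symm.trans hn₁)
  simp only [List.length_append] at hl
  have hpow : (m + 1) ^ i * m < (m + 1) ^ j := calc
    (m + 1) ^ i * m < (m + 1) ^ (i + 1) := by
      rw [pow_succ]; exact Nat.mul_lt_mul_of_pos_left (by omega) (by positivity)
    _ ≤ (m + 1) ^ j := Nat.pow_le_pow_right (by omega) hij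
  have := h₂ j
  have := h₃ i
  omega

/-- The non-terminals of a grammar for the unfolding of `threeBlocksRel`. -/
inductive BlockPhase : Type u
  | start | outer | inner

/-- The productions of a linear indexed grammar that counts the letters of the outer blocks on its
stack. -/
def threeBlocksRules (a b : X) :
    Set (LinearIndexedRule (Option X) BlockPhase.{u} PUnit.{u + 1}) :=
  {.copy .start [] [] .outer [] ([none].map .terminal),
    .copy .outer [] ([some a].map .terminal) .outer [⟨⟩] ([some a].map .terminal),
    .copy .outer [] ([some b].map .terminal) .inner [] ([some b].map .terminal),
    .copy .inner [⟨⟩] ([some a].map .terminal) .inner [] [],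
    .terminate .inner [] []}

theorem threeBlocksRules_isLinear (a b : X) : ∀ r ∈ threeBlocksRules a b, r.IsLinear := by
  rintro r (rfl | rfl | rfl | rfl | rfl)
  · exact ⟨[], _, rfl, rfl⟩
  · exact ⟨_, _, rfl, rfl⟩
  · exact ⟨_, _, rfl, rfl⟩
  · exact ⟨_, [], rfl, rfl⟩
  · trivial

open LinearIndexedRule

theorem replicate_succ_append_replicate_succ {α : Type*} (c d : α) (n : ℕ) (s : List α) :
    List.replicate (n + 1) c ++ d :: (s ++ d :: List.replicate (n + 1) c) =
      [c] ++ (List.replicate n c ++ d :: (s ++ d :: List.replicate n c)) ++ [c] := by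
  nth_rewrite 2 [List.replicate_succ']
  simp [List.replicate_succ]

/-- The words generated by a non-terminal of `threeBlocksRules` with `k` flags on its stack. -/
def BlockPhase.Yields (a b : X) (k : ℕ) (z : List (Option X)) : BlockPhase.{u} → Prop
  | .start => ∃ n, z = List.replicate n (some a) ++ some b :: (List.replicate (n + k) (some a) ++
      some b :: List.replicate n (some a)) ++ [none]
  | .outer => ∃ n, z = List.replicate n (some a) ++ some b :: (List.replicate (n + k) (some a) ++
      some b :: List.replicate n (some a))
  | .inner => z = List.replicate k (some a)

/-- Invariant: the middle block exceeds the outer ones by the number of flags already on the stack.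
-/
theorem yields_of_generates_threeBlocksRules {a b : X} {A : BlockPhase.{u}} {σ : List PUnit}
    {z : List (Option X)} (h : Generates (threeBlocksRules a b) A σ z) :
    A.Yields a b σ.length z := by
  induction h with
  | @copy A pop l B push r rest w hr _ ih =>
    have hinj : Function.Injective (List.map (Symbol.terminal (T := Option X)
        (N := BlockPhase.{u} × List PUnit.{u + 1}))) :=
      List.map_injective_iff.2 fun _ _ h => Symbol.terminal.inj h
    rcases hr with h | h | h | h | h
    · simp only [LinearIndexedRule.copy.injEq, hinj.eq_iff, List.map_eq_nil_iff] at h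
      obtain ⟨rfl, rfl, rfl, rfl, rfl, rfl⟩ := h
      obtain ⟨n, rfl⟩ := ih
      exact ⟨n, by simp⟩
    · simp only [LinearIndexedRule.copy.injEq, hinj.eq_iff] at h
      obtain ⟨rfl, rfl, rfl, rfl, rfl, rfl⟩ := h
      obtain ⟨n, rfl⟩ := ih
      refine ⟨n + 1, ?_⟩
      rw [replicate_succ_append_replicate_succ]
      simp [Nat.add_assoc, Nat.add_comm 1]
    · simp only [LinearIndexedRule.copy.injEq, hinj.eq_iff] at h
      obtain ⟨rfl, rfl, rfl, rfl, rfl, rfl⟩ := h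
      obtain rfl := ih
      exact ⟨0, by simp⟩
    · simp only [LinearIndexedRule.copy.injEq, hinj.eq_iff, List.map_eq_nil_iff] at h
      obtain ⟨rfl, rfl, rfl, rfl, rfl, rfl⟩ := h
      obtain rfl := ih
      simp [BlockPhase.Yields, List.replicate_succ]
    · cases h
  | terminate hr =>
    rcases hr with h | h | h | h | h <;> cases h
    rfl

theorem generates_threeBlocksRules_inner (a b : X) (k : ℕ) :
    Generates (threeBlocksRules a b) .inner (List.replicate k ⟨⟩)
      (List.replicate k (some a)) := by
  induction k with
  | zero => exact .terminate (by simp [threeBlocksRules])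
  | succ k ih =>
    have := Generates.copy (R := threeBlocksRules a b) (pop := [⟨⟩])
      (A := .inner) (push := [])
      (l := [some a]) (r := []) _ (by simp [threeBlocksRules]) ih
    simpa [List.replicate_succ] using this

theorem generates_threeBlocksRules_outer (a b : X) (n k : ℕ) :
    Generates (threeBlocksRules a b) .outer (List.replicate k ⟨⟩)
      (List.replicate n (some a) ++ some b :: (List.replicate (n + k) (some a) ++
        some b :: List.replicate n (some a))) := by
  induction n generalizing k with
  | zero =>
    have := Generates.copy (R := threeBlocksRules a b) (A := .outer) (pop := []) (push := [])
      (l := [some b]) (r := [some b]) _ (by simp [threeBlocksRules])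
      (generates_threeBlocksRules_inner a b k)
    simpa using this
  | succ n ih =>
    have := Generates.copy (R := threeBlocksRules a b) (A := .outer) (pop := []) (push := [⟨⟩])
      (l := [some a]) (r := [some a]) (List.replicate k ⟨⟩) (by simp [threeBlocksRules])
      (ih (k + 1))
    -- The outer pair of letters just written is traded for one more flag.
    rw [show n + 1 + k = n + (k + 1) by omega]
    rw [replicate_succ_append_replicate_succ]
    exact this

theorem unfoldWord_threeBlocks (a b : X) (n : ℕ) :
    unfoldWord (threeBlocks a b n, []) = List.replicate n (some a) ++
      some b :: (List.replicate n (some a) ++ some b :: List.replicate n (some a)) ++ [none] := by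
  simp [unfoldWord, threeBlocks]

theorem threeBlocksRel_mem_unfolded (a b : X) : threeBlocksRel a b ∈ unfolded classLIN X := by
  refine mem_classLIN_of_generates (R := threeBlocksRules a b)
    (by simp [threeBlocksRules]) (threeBlocksRules_isLinear a b) .start ?_
  intro z
  constructor
  · rintro ⟨_, ⟨n, rfl⟩, rfl⟩
    have := Generates.copy (R := threeBlocksRules a b) (A := .start) (pop := []) (push := [])
      (l := []) (r := [none]) _ (by simp [threeBlocksRules])
      (generates_threeBlocksRules_outer a b n 0)
    rw [unfoldWord_threeBlocks]
    simpa using this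
  · intro h
    obtain ⟨n, rfl⟩ := yields_of_generates_threeBlocksRules h
    -- The start stack is empty, so the middle length `n + 0` is `n` by definition.
    exact ⟨_, ⟨n, rfl⟩, unfoldWord_threeBlocks a b n⟩

end ThreeBlocks

theorem proposition5p5 {X : Type u} [Finite X] :
    twoTape classCF X ⊆ unfolded classLIN X ∧
      (2 ≤ Nat.card X → twoTape classCF X ⊂ unfolded classLIN X) := by
  refine ⟨twoTape_classCF_subset, fun hX => ⟨twoTape_classCF_subset, fun h => ?_⟩⟩
  have : Nontrivial X := Finite.one_lt_card_iff_nontrivial.1 hX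
  obtain ⟨a, b, hab⟩ := exists_pair_ne X
  exact threeBlocksRel_not_mem_twoTape hab (h (threeBlocksRel_mem_unfolded a b))
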